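/- **Setting.** Let $I$ be a countable set and let $U=(U_{ij})_{i,j\in I}$ be a real symmetric matrix with $U_{ij}\ge\min\{U_{ik},U_{kj}\}$ for all $i,j,k\in I$. Let $\mathcal W=\{U_{ij}: i,j\in I\}$, and for $w\in\mathcal W$ let $J(w)=\{i: U_{ii}\ge w\}$, with the equivalence relation $i\equiv_w j\Leftrightarrow U_{ij}\ge w$ on $J(w)$. Assume - (H1) if $U_{ik}=U_{jk}$ for all $k\in I$, then $i=j$; - (H2) $\mathcal W\subset(0,\infty)$ has no finite accumulation point; write $\mathcal W=\{w_0<w_1<\cdots\}$ and $w_{-1}=0$; - (H3) $J(w)/\!\equiv_w$ is finite for every $w\in\mathcal W$. The *minimal tree* $\widetilde I$ is the set of pairs $(E,w)$ with $w\in\mathcal W$ and $E\in J(w)/\!\equiv_w$; two pairs $(E,u),(F,v)$ are neighbors if $\{u,v\}=\{w_n,w_{n+1}\}$ for some $n$ and $E\cap F\ne\emptyset$. The site $i\in I$ is identified with $(\{j: U_{ij}\ge U_{ii}\},U_{ii})\in\widetilde I$. The matrix $\widetilde Q$ on $\widetilde I$ is given, at a site $a=(E,w_n)$ having $s_a$ neighbors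 of value $w_{n+1}$, by $$\widetilde Q_{aa}=-\frac1{w_n-w_{n-1}}-\frac{s_a}{w_{n+1}-w_n}$$ (the last term being $0$ if $s_a=0$), by $\widetilde Q_{ab}=|w_n-w_m|^{-1}$ if $b=(F,w_m)$ is a neighbor of $a$, and by $\widetilde Q_{ab}=0$ otherwise. Let $\widetilde X$, with lifetime $\widetilde\zeta$, be the minimal continuous-time Markov chain on $\widetilde I\cup\{\partial_r\}$ with the rates $\widetilde Q$, where moreover the root (the unique site of value $w_0$) jumps to the absorbing point $\partial_r$ at rate $w_0^{-1}$; $\mathbb P_a$ is its law started at $a$. Let $\tau=\inf\{t>0:\widetilde X_t\in I\cup\{\partial_r\}\}\wedge\widetilde\zeta$ and assume - (H4) $\mathbb P_a(\widetilde X_\tau\in I\cup\{\partial_r\})=1$ for all $a\in\widetilde I\setminus I$. Let $Q$ be the matrix on $I$ given by $Q_{ij}=\widetilde Q_{ij}+\sum_{k\in\widetilde I\setminus I}\widetilde Q_{ik}\,\mathbb P_k(\widetilde X_\tau=j)$. A real function $f$ is called $Q$-harmonic (resp. $\widetilde Q$-harmonic) if $Qf=0$ (resp. $\widetilde Qf=0$).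 **Theorem.** Assume (H1)–(H4), and let $h:I\to\mathbb R$ be a bounded $Q$-harmonic function, extended by $h(\partial_r)=0$. Then there is one and only one bounded $\widetilde Q$-harmonic function $\tilde h:\widetilde I\to\mathbb R$ with $\tilde h=h$ on $I$, and it is given by $\tilde h(a)=\mathbb E_a\big(h(\widetilde X_\tau)\big)$ for $a\in\widetilde I$. -/

import Mathlib

open MeasureTheory ProbabilityTheory
open scoped ENNReal

namespace UltraTree

/-! ### The minimal continuous-time Markov chain with a given conservative q-matrix -/

section MarkovChain

variable {S : Type*}

/-- Jump probabilities `R s t / (-R s s)`, `t ≠ s`, of the discrete skeleton.  They all vanish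
when `R s s = 0`, that is when `s` is absorbing. -/
noncomputable def jumpWeight (R : S → S → ℝ) (s t : S) : ℝ≥0∞ :=
  open Classical in if t = s then 0 else ENNReal.ofReal (R s t / (-R s s))

/-- Law of the next state of the skeleton: given by the jump probabilities if they have total mass
one (always so at a non-absorbing state of a conservative q-matrix), and the point mass at `s`
otherwise (so at an absorbing state the skeleton stays there). -/
noncomputable def jumpLaw (R : S → S → ℝ) (s : S) : PMF S :=
  open Classical in
  if h : ∑' t, jumpWeight R s t = 1 then
    ⟨jumpWeight R s, h ▸ ENNReal.summable.hasSum⟩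
  else PMF.pure s

/-- Sample space: trajectories of the skeleton together with a sequence of clocks. -/
abbrev Path (S : Type*) : Type _ := (ℕ → S) × (ℕ → ℝ)

/-- Instant of the `n`-th jump: the holding time at the `k`-th state `s` of the skeleton is
the `k`-th clock divided by the rate `-R s s` (infinite at an absorbing state). -/
noncomputable def jumpTime (R : S → S → ℝ) (ω : Path S) (n : ℕ) : ℝ≥0∞ :=
  ∑ k ∈ Finset.range n,
    ENNReal.ofReal (ω.2 k) / ENNReal.ofReal (-R (ω.1 k) (ω.1 k))

/-- The lifetime (explosion time) of the chain. -/
noncomputable def lifetime (R : S → S → ℝ) (ω : Path S) : ℝ≥0∞ :=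
  ⨆ n, jumpTime R ω n

/-- The chain `X_t`: before the lifetime it is the current state of the skeleton, from the lifetime
on (in particular at `t = ∞`) it is outside of `S`, which is encoded by `none`. -/
noncomputable def chain (R : S → S → ℝ) (ω : Path S) (t : ℝ≥0∞) : Option S :=
  open Classical in
  if t < lifetime R ω then some (ω.1 (sInf {n | t < jumpTime R ω (n + 1)})) else none

/-- `inf {t > 0 : X_t ∈ A}`, or the lifetime if that is smaller. -/
noncomputable def hitTime (R : S → S → ℝ) (A : Set S) (ω : Path S) : ℝ≥0∞ :=
  min (sInf {t : ℝ≥0∞ | 0 < t ∧ ∃ s ∈ A, chain R ω t = some s}) (lifetime R ω)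

/-- The state `X_τ` at the time `τ = hitTime R A`. -/
noncomputable def hitState (R : S → S → ℝ) (A : Set S) (ω : Path S) : Option S :=
  chain R ω (hitTime R A ω)

variable [MeasurableSpace S] [DiscreteMeasurableSpace S]

/-- One-step transition kernel of the skeleton. -/
noncomputable def jumpKernel (R : S → S → ℝ) : Kernel S S where
  toFun s := (jumpLaw R s).toMeasure
  measurable' := Measurable.of_discrete

instance (R : S → S → ℝ) : IsMarkovKernel (jumpKernel R) :=
  ⟨fun s => inferInstanceAs (IsProbabilityMeasure (jumpLaw R s).toMeasure)⟩

/-- Transition at step `n` given the past: it only looks at the current state. -/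
noncomputable def stepKernel (R : S → S → ℝ) (n : ℕ) :
    Kernel ((i : Finset.Iic n) → (fun _ : ℕ => S) i) S :=
  (jumpKernel R).comap (fun x => x ⟨n, Finset.mem_Iic.2 le_rfl⟩) (measurable_pi_apply _)

instance (R : S → S → ℝ) (n : ℕ) : IsMarkovKernel (stepKernel R n) := by
  unfold stepKernel; infer_instance

/-- Law of the chain started at `s`: the skeleton is the discrete Markov chain with the kernel
`jumpKernel R` started at `s`, the clocks are independent exponential variables of mean one,
independent of the skeleton. -/
noncomputable def chainLaw (R : S → S → ℝ) (s : S) : Measure (Path S) :=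
  (Kernel.traj (X := fun _ : ℕ => S) (stepKernel R) 0 (fun _ => s)).prod
    (Measure.infinitePi (fun _ : ℕ => expMeasure 1))

end MarkovChain

/-! ### A state space with one additional absorbing point `∂_r` -/

/-- The sites together with the additional point `∂_r`. -/
inductive WithCemetery (V : Type*) where
  | site (v : V) : WithCemetery V
  | cemetery : WithCemetery V

instance (V : Type*) : MeasurableSpace (WithCemetery V) := ⊤

instance (V : Type*) : DiscreteMeasurableSpace (WithCemetery V) := ⟨fun _ => trivial⟩

/-! ### Ultrametric arrangements and their minimal tree -/

section Ultrametric

variable {I : Type*}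

/-- Symmetric arrangements that verify the ultrametric inequality. -/
structure IsUltrametric (U : I → I → ℝ) : Prop where
  symm : ∀ i j, U i j = U j i
  ultra : ∀ i j k, min (U i k) (U k j) ≤ U i j

/-- The set `𝒲` of values of `U`. -/
def values (U : I → I → ℝ) : Set ℝ := {w | ∃ i j, U i j = w}

/-- The class of `i` for the relation `j ≡_w k ↔ w ≤ U j k` on `J(w) = {j | w ≤ U j j}`
(`i` is meant to belong to `J(w)`). -/
def classOf (U : I → I → ℝ) (w : ℝ) (i : I) : Set I := {j | w ≤ U j j ∧ w ≤ U i j}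

/-- The quotient set `J(w) / ≡_w`, as a set of subsets of `I`. -/
def classes (U : I → I → ℝ) (w : ℝ) : Set (Set I) :=
  {E | ∃ i, w ≤ U i i ∧ E = classOf U w i}

/-- The set of sites `Ĩ` of the minimal tree: the pairs `(E, w)` with `w ∈ 𝒲` and `E` a class
of `≡_w`.  The value `w` is also the diagonal entry `Ũ(ĩ, ĩ)` of the minimal tree matrix. -/
@[ext] structure MinTree (U : I → I → ℝ) where
  cls : Set I
  val : ℝ
  val_mem : val ∈ values U
  cls_mem : cls ∈ classes U val

/-- The immersion of `I` into `Ĩ`, `i ↦ (E_i^{U_ii}, U_ii)`. -/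
def emb (U : I → I → ℝ) (i : I) : MinTree U where
  cls := classOf U (U i i) i
  val := U i i
  val_mem := ⟨i, i, rfl⟩
  cls_mem := ⟨i, le_rfl, rfl⟩

/-- `u < v` are consecutive elements of `𝒲`. -/
def Consecutive (U : I → I → ℝ) (u v : ℝ) : Prop :=
  u ∈ values U ∧ v ∈ values U ∧ u < v ∧ ∀ z ∈ values U, ¬ (u < z ∧ z < v)

/-- The neighbor relation `𝒯̃` of the minimal tree. -/
def Adj (U : I → I → ℝ) (a b : MinTree U) : Prop :=
  (Consecutive U a.val b.val ∨ Consecutive U b.val a.val) ∧ (a.cls ∩ b.cls).Nonempty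

/-- The successors of a site of the minimal tree (its neighbors that are farther from the root). -/
def successors (U : I → I → ℝ) (a : MinTree U) : Set (MinTree U) :=
  {b | Adj U a b ∧ a.val < b.val}

/-- For `w = w_n` the preceding value `w_{n-1}`, where `w_{-1} = 0`. -/
noncomputable def prevValue (U : I → I → ℝ) (w : ℝ) : ℝ :=
  sSup {v | v ∈ insert 0 (values U) ∧ v < w}

/-- For `w = w_n` the following value `w_{n+1}` (only used at sites that have successors). -/
noncomputable def nextValue (U : I → I → ℝ) (w : ℝ) : ℝ :=
  sInf {v | v ∈ values U ∧ w < v}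

/-- The q-matrix `Q̃` of the minimal tree matrix: between neighbors it is the inverse of the
difference of their values, on the diagonal it is
`-((w_n - w_{n-1})⁻¹ + |S| (w_{n+1} - w_n)⁻¹)` at a site of value `w_n` with set of successors
`S`, and it vanishes elsewhere. -/
noncomputable def treeGen (U : I → I → ℝ) (a b : MinTree U) : ℝ :=
  open Classical in
  if a = b then
    -((a.val - prevValue U a.val)⁻¹
      + ((successors U a).ncard : ℝ) * (nextValue U a.val - a.val)⁻¹)
  else if Adj U a b then |a.val - b.val|⁻¹
  else 0

/-- The extension of `Q̃` to `Ĩ ∪ {∂_r}`: the root (the site of value `w_0 = min 𝒲`) is linked to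
`∂_r` with rate `w_0⁻¹`, and `∂_r` is absorbing. -/
noncomputable def extGen (U : I → I → ℝ) :
    WithCemetery (MinTree U) → WithCemetery (MinTree U) → ℝ
  | .site a, .site b => treeGen U a b
  | .site a, .cemetery => open Classical in if ∀ w ∈ values U, a.val ≤ w then a.val⁻¹ else 0
  | .cemetery, _ => 0

/-- The set `I ∪ {∂_r}` inside of `Ĩ ∪ {∂_r}`. -/
def target (U : I → I → ℝ) : Set (WithCemetery (MinTree U)) :=
  {s | s = .cemetery ∨ ∃ i, s = .site (emb U i)}

/-- The law `P_ĩ` of the Markov process `X̃` associated with `Q̃` started at a site `ĩ`. -/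
noncomputable def treeLaw (U : I → I → ℝ) (a : MinTree U) :
    Measure (Path (WithCemetery (MinTree U))) :=
  chainLaw (extGen U) (.site a)

/-- The variable `X̃_τ`, where `τ = inf {t > 0 : X̃_t ∈ I ∪ {∂_r}} ∧ ζ̃` (`none` if `τ` is the
lifetime `ζ̃`). -/
noncomputable def exitState (U : I → I → ℝ) (ω : Path (WithCemetery (MinTree U))) :
    Option (WithCemetery (MinTree U)) :=
  hitState (extGen U) (target U) ω

/-- The q-matrix `Q` of an ultrametric arrangement,
`Q_ij = Q̃_ij + ∑_{k̃ ∈ Ĩ \ I} Q̃_{i k̃} P_k̃(X̃_τ = j)` (a sum with finitely many nonzero terms when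
the minimal tree is locally finite). -/
noncomputable def gen (U : I → I → ℝ) (i j : I) : ℝ :=
  treeGen U (emb U i) (emb U j) +
    ∑' k : {k : MinTree U // k ∉ Set.range (emb U)},
      treeGen U (emb U i) k *
        (treeLaw U k).real {ω | exitState U ω = some (.site (emb U j))}

/-- The random variable `h(X̃_τ)`, where `h` is extended by `0` outside of `I`
(in particular at `∂_r`). -/
noncomputable def exitValue (U : I → I → ℝ) (h : I → ℝ)
    (ω : Path (WithCemetery (MinTree U))) : ℝ :=
  Function.extend (fun i : I => some (WithCemetery.site (emb U i))) h (fun _ => 0)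
    (exitState U ω)

/-- `h` is harmonic for `R`, that is `R h = 0`: each series `∑_j R_ij h(j)` converges
(unconditionally) and its sum is `0`. -/
def IsHarmonic {V : Type*} (R : V → V → ℝ) (h : V → ℝ) : Prop :=
  ∀ i, HasSum (fun j => R i j * h j) 0

/-- Boundedness of a real function. -/
def IsBoundedFun {V : Type*} (h : V → ℝ) : Prop := ∃ C : ℝ, ∀ i, |h i| ≤ C

/-- Condition (H1): equivalent points coincide. -/
def H1 (U : I → I → ℝ) : Prop := ∀ i j, (∀ k, U i k = U j k) ↔ i = j

/-- Condition (H2): the values are strictly positive and have no finite accumulation point. -/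
def H2 (U : I → I → ℝ) : Prop :=
  (∀ w ∈ values U, 0 < w) ∧ ∀ x : ℝ, ¬ AccPt x (Filter.principal (values U))

/-- Condition (H3): there are finitely many classes at each level. -/
def H3 (U : I → I → ℝ) : Prop := ∀ w ∈ values U, (classes U w).Finite

/-- Condition (H4): started outside of `I`, the process `X̃` reaches `I ∪ {∂_r}` almost surely. -/
def H4 (U : I → I → ℝ) : Prop :=
  ∀ a : MinTree U, a ∉ Set.range (emb U) →
    treeLaw U a {ω | ∃ s ∈ target U, exitState U ω = some s} = 1

end Ultrametric

end UltraTree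

/-! Existence is the strong form of a Dirichlet problem. Exponential clocks are almost surely
positive, so `X_τ` is the first state of `I ∪ {∂_r}` visited by the discrete skeleton
(`hitState_ae_eq`), and the candidate extension is the mean of `h` at that first visit, `hitMean`.
Dividing a conservative row of the generator by its diagonal entry turns "generator vanishes" into
"mean value property for one jump" (`integral_jumpKernel_eq_iff`), and `hitMean` has that property
off the target (`hitMean_harmonic`).

At a site of `I` the mean value property can fail for a general `h`. There, inserting the definition
of `Q` and exchanging a finite sum over neighbors with the series for `E_k h(X_τ)` gives `Q̃ h' = Q
h` on `I`, which is `0` by hypothesis (`hasSum_treeGen_hitMean_emb`). The exchange is harmless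
because the minimal tree is locally finite.

Uniqueness is optional stopping: a bounded `Q̃`-harmonic function, put equal to `0` at `∂_r`, has
constant mean along the skeleton stopped at the target (`integral_stopped_eq`). By (H4) the stopped
skeleton is eventually constant almost surely, and bounded convergence recovers the function from
its values on `I` (`eq_integral_firstHit`). -/

namespace UltraTree

/-! ### First visits of the skeleton and of the continuous-time chain. -/

section Skeleton

open Filter Topology

variable {S : Type*}

/-- The state of `A` that the sequence `y` visits first (`none` if it never visits `A`). -/
noncomputable def firstHit (A : Set S) (y : ℕ → S) : Option S :=
  open Classical in if h : ∃ n, y n ∈ A then some (y (Nat.find h)) else none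

/-- The sequence `y` stopped at its first visit of `A`. -/
noncomputable def stopped (A : Set S) (y : ℕ → S) : ℕ → S
  | 0 => y 0
  | n + 1 => open Classical in if stopped A y n ∈ A then stopped A y n else y (n + 1)

lemma stopped_succ_of_mem {A : Set S} {y : ℕ → S} {n : ℕ} (h : stopped A y n ∈ A) :
    stopped A y (n + 1) = stopped A y n := by
  simp [stopped, h]

lemma stopped_succ_of_notMem {A : Set S} {y : ℕ → S} {n : ℕ} (h : stopped A y n ∉ A) :
    stopped A y (n + 1) = y (n + 1) := by
  simp [stopped, h]

lemma stopped_eq_of_notMem {A : Set S} {y : ℕ → S} {n : ℕ} (h : stopped A y n ∉ A) :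
    stopped A y n = y n := by
  cases n with
  | zero => rfl
  | succ n =>
    by_cases hn : stopped A y n ∈ A
    · exact absurd (stopped_succ_of_mem hn ▸ hn) h
    · exact stopped_succ_of_notMem hn

lemma stopped_notMem_iff {A : Set S} {y : ℕ → S} {n : ℕ} :
    stopped A y n ∉ A ↔ ∀ k ≤ n, y k ∉ A := by
  induction n with
  | zero => simp [stopped]
  | succ n ih =>
    by_cases hn : stopped A y n ∈ A
    · rw [stopped_succ_of_mem hn]
      refine ⟨fun h => absurd hn h, fun h => ?_⟩
      exact absurd hn (ih.2 fun k hk => h k (hk.trans n.le_succ))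
    · rw [stopped_succ_of_notMem hn]
      refine ⟨fun h k hk => ?_, fun h => h _ le_rfl⟩
      rcases Nat.of_le_succ hk with hk | rfl
      · exact ih.1 hn k hk
      · exact h

lemma stopped_eq_of_find {A : Set S} {y : ℕ → S} {N : ℕ} (hN : y N ∈ A)
    (hlt : ∀ k < N, y k ∉ A) {n : ℕ} (hn : N ≤ n) : stopped A y n = y N := by
  induction n, hn using Nat.le_induction with
  | base =>
    cases N with
    | zero => rfl
    | succ N =>
      exact stopped_succ_of_notMem (stopped_notMem_iff.2 fun k hk => hlt k (Nat.lt_succ_of_le hk))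
  | succ n hn ih => rw [stopped_succ_of_mem (ih ▸ hN), ih]

lemma firstHit_eq_some {A : Set S} {y : ℕ → S} {N : ℕ} (hN : y N ∈ A)
    (hlt : ∀ k < N, y k ∉ A) : firstHit A y = some (y N) := by
  classical
  have h : ∃ n, y n ∈ A := ⟨N, hN⟩
  have : Nat.find h = N := (Nat.find_eq_iff h).2 ⟨hN, hlt⟩
  simp only [firstHit, dif_pos h, this]

lemma firstHit_eq_none {A : Set S} {y : ℕ → S} (h : ∀ n, y n ∉ A) : firstHit A y = none :=
  dif_neg (by simpa using h)

/-- Either a sequence has a first visit of `A`, or it never visits `A`. -/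
lemma exists_first_visit (A : Set S) (y : ℕ → S) :
    (∃ N, y N ∈ A ∧ ∀ k < N, y k ∉ A) ∨ ∀ n, y n ∉ A := by
  classical
  by_cases h : ∃ n, y n ∈ A
  · exact Or.inl ⟨Nat.find h, Nat.find_spec h, fun k hk => Nat.find_min h hk⟩
  · exact Or.inr (by simpa using h)

lemma tendsto_stopped {A : Set S} {y : ℕ → S} {N : ℕ} (hN : y N ∈ A)
    (hlt : ∀ k < N, y k ∉ A) (g : S → ℝ) :
    Tendsto (fun n => g (stopped A y n)) atTop (𝓝 ((firstHit A y).elim 0 g)) := by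
  rw [firstHit_eq_some hN hlt]
  refine tendsto_const_nhds.congr' ?_
  filter_upwards [eventually_ge_atTop N] with n hn
  simp [stopped_eq_of_find hN hlt hn]

lemma abs_elim_le {f : S → ℝ} {C : ℝ} (hC : 0 ≤ C) (hf : ∀ s, |f s| ≤ C) (z : Option S) :
    |z.elim 0 f| ≤ C := by
  cases z with
  | none => simpa using hC
  | some s => exact hf s

/-! #### The path of the continuous-time chain -/

lemma jumpTime_succ (R : S → S → ℝ) (ω : Path S) (n : ℕ) :
    jumpTime R ω (n + 1) =
      jumpTime R ω n + ENNReal.ofReal (ω.2 n) / ENNReal.ofReal (-R (ω.1 n) (ω.1 n)) :=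
  Finset.sum_range_succ _ _

lemma jumpTime_monotone (R : S → S → ℝ) (ω : Path S) : Monotone (jumpTime R ω) :=
  monotone_nat_of_le_succ fun n => by rw [jumpTime_succ]; exact le_self_add

lemma jumpTime_le_lifetime (R : S → S → ℝ) (ω : Path S) (n : ℕ) :
    jumpTime R ω n ≤ lifetime R ω :=
  le_iSup (jumpTime R ω) n

lemma jumpTime_lt_succ {R : S → S → ℝ} {ω : Path S} {n : ℕ} (hω : 0 < ω.2 n)
    (hn : jumpTime R ω n ≠ ⊤) : jumpTime R ω n < jumpTime R ω (n + 1) := by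
  rw [jumpTime_succ]
  -- A zero rate is allowed here: the holding time is then `⊤`, which is still positive.
  exact ENNReal.lt_add_right hn
    (ENNReal.div_pos (by simpa using hω) ENNReal.ofReal_ne_top).ne'

lemma chain_eq_some {R : S → S → ℝ} {ω : Path S} {n : ℕ} {t : ℝ≥0∞}
    (h₁ : jumpTime R ω n ≤ t) (h₂ : t < jumpTime R ω (n + 1)) :
    chain R ω t = some (ω.1 n) := by
  have hn : sInf {m | t < jumpTime R ω (m + 1)} = n := by
    apply le_antisymm (Nat.sInf_le h₂)
    refine le_csInf ⟨n, h₂⟩ fun m hm => ?_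
    by_contra hlt
    exact absurd (hm.trans_le (jumpTime_monotone R ω (by omega : m + 1 ≤ n))) (not_lt.2 h₁)
  rw [chain, if_pos (h₂.trans_le (jumpTime_le_lifetime R ω _)), hn]

lemma exists_of_chain_eq_some {R : S → S → ℝ} {ω : Path S} {t : ℝ≥0∞} {s : S}
    (h : chain R ω t = some s) :
    ∃ n, jumpTime R ω n ≤ t ∧ t < jumpTime R ω (n + 1) ∧ ω.1 n = s := by
  have ht : t < lifetime R ω := by
    by_contra ht
    simp [chain, ht] at h
  have hex : ∃ n, t < jumpTime R ω n := lt_iSup_iff.1 ht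
  classical
  obtain ⟨n, hn⟩ : ∃ n, Nat.find hex = n + 1 := by
    refine Nat.exists_eq_succ_of_ne_zero fun h0 => ?_
    have := Nat.find_spec hex
    rw [h0] at this
    simp [jumpTime] at this
  have h₁ : jumpTime R ω n ≤ t := not_lt.1 (Nat.find_min hex (by omega : n < Nat.find hex))
  have h₂ : t < jumpTime R ω (n + 1) := hn ▸ Nat.find_spec hex
  refine ⟨n, h₁, h₂, ?_⟩
  rw [chain_eq_some h₁ h₂] at h
  exact Option.some.inj h

/-- If all clocks are positive, then `X_τ` is the first state of `A` visited by the skeleton. -/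
lemma hitState_eq_firstHit {R : S → S → ℝ} {A : Set S} (hR : ∀ s ∉ A, R s s < 0)
    {ω : Path S} (hω : ∀ n, 0 < ω.2 n) : hitState R A ω = firstHit A ω.1 := by
  rcases exists_first_visit A ω.1 with ⟨N, hN, hlt⟩ | hno
  · rw [firstHit_eq_some hN hlt]
    -- Only states before the first visit contribute, and these have nonzero rate. The visited state
    -- itself may be absorbing.
    have hfin : ∀ n ≤ N, jumpTime R ω n ≠ ⊤ := by
      intro n hn
      refine (ENNReal.sum_lt_top.2 fun k hk => ?_).ne
      refine ENNReal.div_lt_top ENNReal.ofReal_ne_top ?_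
      have := hR _ (hlt k ((Finset.mem_range.1 hk).trans_le hn))
      simpa using this
    have hN1 := jumpTime_lt_succ (hω N) (hfin N le_rfl)
    have htime : hitTime R A ω = jumpTime R ω N := by
      have : sInf {t : ℝ≥0∞ | 0 < t ∧ ∃ s ∈ A, chain R ω t = some s} = jumpTime R ω N := by
        apply le_antisymm
        · refine le_of_forall_gt_imp_ge_of_dense fun t ht => ?_
          obtain ⟨r, hr₁, hr₂⟩ := exists_between (lt_min ht hN1)
          refine (sInf_le ?_).trans (hr₂.le.trans (min_le_left _ _))
          exact ⟨zero_le.trans_lt hr₁, _, hN,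
            chain_eq_some hr₁.le (hr₂.trans_le (min_le_right _ _))⟩
        · refine le_sInf ?_
          rintro t ⟨-, s, hs, ht⟩
          obtain ⟨n, h₁, -, rfl⟩ := exists_of_chain_eq_some ht
          refine (jumpTime_monotone R ω ?_).trans h₁
          by_contra hn
          exact hlt n (not_le.1 hn) hs
      rw [hitTime, this, min_eq_left (jumpTime_le_lifetime R ω N)]
    rw [hitState, htime, chain_eq_some le_rfl hN1]
  · rw [firstHit_eq_none hno]
    have hempty : {t : ℝ≥0∞ | 0 < t ∧ ∃ s ∈ A, chain R ω t = some s} = ∅ := by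
      refine Set.eq_empty_of_forall_notMem ?_
      rintro t ⟨-, s, hs, ht⟩
      obtain ⟨n, -, -, rfl⟩ := exists_of_chain_eq_some ht
      exact hno n hs
    -- The infimum of the empty set is `⊤`, so the minimum is the lifetime, from which on the chain
    -- is `none`.
    rw [hitState, hitTime, hempty]
    simp [chain]

variable [MeasurableSpace S] [DiscreteMeasurableSpace S]

/-- Law of the skeleton started at `s`. -/
noncomputable def skeletonLaw (R : S → S → ℝ) (s : S) : Measure (ℕ → S) :=
  Kernel.traj (X := fun _ : ℕ => S) (stepKernel R) 0 (fun _ => s)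

instance (R : S → S → ℝ) (s : S) : IsProbabilityMeasure (skeletonLaw R s) := by
  unfold skeletonLaw; infer_instance

lemma expMeasure_ae_pos : ∀ᵐ x ∂(expMeasure 1), 0 < x := by
  have h : expMeasure 1 (Set.Iic 0) = 0 := by
    have : IsProbabilityMeasure (expMeasure 1) := isProbabilityMeasure_expMeasure one_pos
    have := cdf_expMeasure_eq one_pos 0
    rw [cdf_eq_real] at this
    simpa [measureReal_def, ENNReal.toReal_eq_zero_iff] using this
  rw [ae_iff]
  simpa [Set.Iic] using h

lemma measurePreserving_fst_chainLaw (R : S → S → ℝ) (s : S) :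
    MeasurePreserving Prod.fst (chainLaw R s) (skeletonLaw R s) := by
  have : IsProbabilityMeasure (expMeasure 1) := isProbabilityMeasure_expMeasure one_pos
  exact measurePreserving_fst

instance (R : S → S → ℝ) (s : S) : IsProbabilityMeasure (chainLaw R s) := by
  have : IsProbabilityMeasure (expMeasure 1) := isProbabilityMeasure_expMeasure one_pos
  unfold chainLaw; infer_instance

/-- The clocks now disappear: almost surely all of them are positive, a countable intersection of
full events, and the pathwise identity applies. -/
lemma hitState_ae_eq {R : S → S → ℝ} {A : Set S} (hR : ∀ s ∉ A, R s s < 0) (s : S) :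
    ∀ᵐ ω ∂(chainLaw R s), hitState R A ω = firstHit A ω.1 := by
  have : IsProbabilityMeasure (expMeasure 1) := isProbabilityMeasure_expMeasure one_pos
  have h : ∀ᵐ c ∂(Measure.infinitePi (fun _ : ℕ => expMeasure 1)), ∀ n, 0 < c n := by
    rw [ae_all_iff]
    intro n
    exact (measurePreserving_eval_infinitePi (fun _ : ℕ => expMeasure 1) n).quasiMeasurePreserving.ae
      expMeasure_ae_pos
  have h' := (Measure.quasiMeasurePreserving_snd
    (μ := Kernel.traj (X := fun _ : ℕ => S) (stepKernel R) 0 (fun _ => s))).ae h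
  filter_upwards [h'] with ω hω using hitState_eq_firstHit hR hω

end Skeleton

/-! ### Optional stopping and the Dirichlet problem for the skeleton. -/

section Martingale

open Filter Topology

variable {S : Type*} [MeasurableSpace S] [DiscreteMeasurableSpace S]

lemma measurable_stopped (A : Set S) (n : ℕ) : Measurable fun y : ℕ → S => stopped A y n := by
  induction n with
  | zero => exact measurable_pi_apply 0
  | succ n ih =>
    classical
    simp only [stopped]
    exact Measurable.ite (ih (MeasurableSet.of_discrete (s := A))) ih (measurable_pi_apply _)

lemma integrable_comp_stopped {A : Set S} {μ : Measure (ℕ → S)} [IsFiniteMeasure μ]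
    {g : S → ℝ} {C : ℝ} (hg : ∀ s, |g s| ≤ C) (n : ℕ) :
    Integrable (fun y => g (stopped A y n)) μ :=
  Integrable.of_bound
    ((Measurable.of_discrete (f := g)).comp (measurable_stopped A n)).aestronglyMeasurable C
    (.of_forall fun _ => hg _)

lemma integral_skeletonLaw_zero (R : S → S → ℝ) (s : S) (g : S → ℝ) :
    ∫ y, g (y 0) ∂(skeletonLaw R s) = g s := by
  rw [skeletonLaw, Kernel.integral_traj]
  · simp [Function.updateFinset]
  · exact ((Measurable.of_discrete (f := g)).comp (measurable_pi_apply 0)).aestronglyMeasurable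

/-- Mean of `f` at the first visit of `A` during the first `n` steps, by backward recursion. -/
noncomputable def hitIter (R : S → S → ℝ) (A : Set S) (f : S → ℝ) : ℕ → S → ℝ
  | 0, s => A.indicator f s
  | n + 1, s => open Classical in
      if s ∈ A then f s else ∫ t, hitIter R A f n t ∂(jumpKernel R s)

lemma hitIter_of_mem (R : S → S → ℝ) {A : Set S} (f : S → ℝ) (n : ℕ) {s : S} (hs : s ∈ A) :
    hitIter R A f n s = f s := by
  cases n <;> simp [hitIter, hs]

lemma hitIter_succ_of_notMem (R : S → S → ℝ) {A : Set S} (f : S → ℝ) (n : ℕ) {s : S}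
    (hs : s ∉ A) : hitIter R A f (n + 1) s = ∫ t, hitIter R A f n t ∂(jumpKernel R s) := by
  simp [hitIter, hs]

lemma abs_hitIter_le (R : S → S → ℝ) (A : Set S) {f : S → ℝ} {C : ℝ} (hf : ∀ s, |f s| ≤ C)
    (n : ℕ) (s : S) : |hitIter R A f n s| ≤ C := by
  by_cases hs : s ∈ A
  · rw [hitIter_of_mem R f n hs]; exact hf s
  induction n generalizing s with
  | zero => simpa [hitIter, hs] using (abs_nonneg _).trans (hf s)
  | succ n ih =>
    rw [hitIter_succ_of_notMem R f n hs]
    have : ∀ t, ‖hitIter R A f n t‖ ≤ C := fun t => by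
      by_cases ht : t ∈ A
      · rw [hitIter_of_mem R f n ht]; exact hf t
      · exact ih t ht
    simpa using norm_integral_le_of_norm_le_const (μ := jumpKernel R s) (.of_forall this)

/-- Mean of `f` at the first visit of `A`. -/
noncomputable def hitMean (R : S → S → ℝ) (A : Set S) (f : S → ℝ) (s : S) : ℝ :=
  ∫ y, (firstHit A y).elim 0 f ∂(skeletonLaw R s)

lemma abs_hitMean_le (R : S → S → ℝ) (A : Set S) {f : S → ℝ} {C : ℝ} (hf : ∀ s, |f s| ≤ C)
    (s : S) : |hitMean R A f s| ≤ C := by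
  have : ∀ y, ‖(firstHit A y).elim 0 f‖ ≤ C := fun y =>
    abs_elim_le ((abs_nonneg _).trans (hf s)) hf _
  simpa [hitMean] using norm_integral_le_of_norm_le_const (μ := skeletonLaw R s) (.of_forall this)

variable [Countable S]

lemma measurableSet_firstHit_preimage (A : Set S) (B : Set (Option S)) :
    MeasurableSet (firstHit A ⁻¹' B) := by
  let _ : MeasurableSpace (Option S) := ⊤
  have hmem : ∀ n, MeasurableSet {y : ℕ → S | y n ∈ A} := fun n =>
    measurable_pi_apply n (MeasurableSet.of_discrete (s := A))
  suffices h : Measurable (firstHit A) from h trivial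
  refine measurable_to_countable' fun z => ?_
  have hfirst : ∀ n, MeasurableSet {y : ℕ → S | y n ∈ A ∧ ∀ k < n, y k ∉ A} := fun n => by
    have : {y : ℕ → S | y n ∈ A ∧ ∀ k < n, y k ∉ A} =
        {y : ℕ → S | y n ∈ A} ∩ ⋂ k, ⋂ _ : k < n, {y : ℕ → S | y k ∈ A}ᶜ := by
      ext y; simp
    rw [this]
    exact (hmem n).inter
      (MeasurableSet.iInter fun k => MeasurableSet.iInter fun _ => (hmem k).compl)
  rcases z with _ | s
  · have : firstHit A ⁻¹' {none} = ⋂ n, {y : ℕ → S | y n ∈ A}ᶜ := by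
      ext y
      rcases exists_first_visit A y with ⟨N, hN, hlt⟩ | hno
      · simp only [Set.mem_preimage, firstHit_eq_some hN hlt]
        simpa using ⟨N, hN⟩
      · simpa [firstHit_eq_none hno] using hno
    rw [this]
    exact MeasurableSet.iInter fun n => (hmem n).compl
  · have : firstHit A ⁻¹' {some s} =
        ⋃ n, {y : ℕ → S | y n ∈ A ∧ ∀ k < n, y k ∉ A} ∩ (fun y => y n) ⁻¹' {s} := by
      ext y
      rcases exists_first_visit A y with ⟨N, hN, hlt⟩ | hno
      · simp only [Set.mem_preimage, firstHit_eq_some hN hlt, Set.mem_iUnion]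
        constructor
        · intro h
          exact ⟨N, ⟨hN, hlt⟩, by simpa using h⟩
        · rintro ⟨n, ⟨hn, hn'⟩, rfl⟩
          have : n = N := by
            by_contra hne
            rcases lt_or_gt_of_ne hne with h | h
            · exact hlt _ h hn
            · exact hn' _ h hN
          rw [this]; rfl
      · simpa [firstHit_eq_none hno] using fun n hn => absurd hn (hno n)
    rw [this]
    exact MeasurableSet.iUnion fun n => (hfirst n).inter
      (measurable_pi_apply n (MeasurableSet.of_discrete (s := {s})))

lemma measurable_comp_firstHit (A : Set S) (φ : Option S → ℝ) :
    Measurable fun y => φ (firstHit A y) := fun B _ =>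
  measurableSet_firstHit_preimage A (φ ⁻¹' B)

/-- The increment of a process that is harmonic off `A`, between the instants `n` and `n + 1`,
has mean zero on the event that `A` has not been visited before. -/
lemma integral_increment_eq_zero {R : S → S → ℝ} {A : Set S} {g g' : S → ℝ} {C : ℝ}
    (hg : ∀ s, |g s| ≤ C) (hg' : ∀ s, |g' s| ≤ C)
    (hstep : ∀ s ∉ A, ∫ t, g' t ∂(jumpKernel R s) = g s) (s : S) (n : ℕ) :
    ∫ y, {y : ℕ → S | ∀ k ≤ n, y k ∉ A}.indicator (fun y => g' (y (n + 1)) - g (y n)) y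
      ∂(skeletonLaw R s) = 0 := by
  classical
  let x₀ : (i : Finset.Iic 0) → (fun _ : ℕ => S) i := fun _ => s
  let L : Finset.Iic n := ⟨n, Finset.mem_Iic.2 le_rfl⟩
  let φ : ((i : Finset.Iic n) → (fun _ : ℕ => S) i) × S → ℝ := fun p =>
    if ∀ k, p.1 k ∉ A then g' p.2 - g (p.1 L) else 0
  -- A finite power of a countable discrete space is again discrete.
  have hφ : Measurable φ := Measurable.of_discrete
  -- The Markov property: the next state, jointly with the past up to `n`, is distributed by one
  -- step of the kernel.
  have hmap := Kernel.partialTraj_compProd_eq_map_traj (X := fun _ : ℕ => S) (κ := stepKernel R) (Nat.zero_le n)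
    (x₀ := x₀)
  have hpair : Measurable fun y : ℕ → S => (Preorder.frestrictLe n y, y (n + 1)) := by fun_prop
  have hint : Integrable φ
      ((Kernel.partialTraj (X := fun _ : ℕ => S) (stepKernel R) 0 n x₀) ⊗ₘ stepKernel R n) := by
    refine Integrable.of_bound hφ.aestronglyMeasurable (C + C) (.of_forall fun p => ?_)
    simp only [φ]
    split_ifs
    · exact (abs_sub _ _).trans (add_le_add (hg' _) (hg _))
    · simpa using add_nonneg ((abs_nonneg _).trans (hg s)) ((abs_nonneg _).trans (hg s))
  calc ∫ y, {y : ℕ → S | ∀ k ≤ n, y k ∉ A}.indicator (fun y => g' (y (n + 1)) - g (y n)) y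
        ∂(skeletonLaw R s)
      = ∫ y, φ (Preorder.frestrictLe n y, y (n + 1)) ∂(skeletonLaw R s) := by
        refine integral_congr_ae (.of_forall fun y => ?_)
        simp [φ, L, Set.indicator_apply]
        congr
    _ = ∫ p, φ p ∂((Kernel.partialTraj (X := fun _ : ℕ => S) (stepKernel R) 0 n x₀) ⊗ₘ stepKernel R n) := by
        rw [hmap, integral_map hpair.aemeasurable hφ.aestronglyMeasurable]
        rfl
    _ = ∫ x, ∫ t, φ (x, t) ∂(stepKernel R n x)
          ∂(Kernel.partialTraj (X := fun _ : ℕ => S) (stepKernel R) 0 n x₀) :=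
        Measure.integral_compProd hint
    _ = 0 := by
        refine integral_eq_zero_of_ae (.of_forall fun x => ?_)
        by_cases hx : ∀ k, x k ∉ A
        · have h := hstep _ (hx L)
          have hi : Integrable g' (jumpKernel R (x L)) :=
            Integrable.of_bound (Measurable.of_discrete (f := g')).aestronglyMeasurable C
              (.of_forall hg')
          have : stepKernel R n x = jumpKernel R (x L) := rfl
          simp only [φ, this, if_pos hx, Pi.zero_apply]
          rw [integral_sub hi (integrable_const _), h]
          simp
        · simp only [φ, if_neg hx, integral_zero, Pi.zero_apply]

/-- A bounded time-dependent function that is constant in time on `A` and harmonic off `A` up to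
the time `n` has constant mean along the stopped skeleton. -/
lemma integral_stopped_eq {R : S → S → ℝ} {A : Set S} {u : ℕ → S → ℝ} {C : ℝ}
    (hu : ∀ k s, |u k s| ≤ C) (hA : ∀ k, ∀ s ∈ A, u (k + 1) s = u k s) {n : ℕ}
    (hstep : ∀ k < n, ∀ s ∉ A, ∫ t, u (k + 1) t ∂(jumpKernel R s) = u k s) (s : S) :
    ∫ y, u n (stopped A y n) ∂(skeletonLaw R s) = u 0 s := by
  induction n with
  | zero => exact integral_skeletonLaw_zero R s (u 0)
  | succ n ih =>
    rw [← ih fun k hk => hstep k (hk.trans n.lt_succ_self), ← sub_eq_zero,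
      ← integral_sub (integrable_comp_stopped (hu _) _) (integrable_comp_stopped (hu _) _),
      ← integral_increment_eq_zero (hu n) (hu (n + 1)) (hstep n n.lt_succ_self) s n]
    -- The stopped sequence has either entered `A`, where both it and `u` no longer change, or still
    -- agrees with the skeleton, where the increment is that of the unstopped process.
    refine integral_congr_ae (.of_forall fun y => ?_)
    by_cases hy : stopped A y n ∈ A
    · have : y ∉ {y : ℕ → S | ∀ k ≤ n, y k ∉ A} := fun h => stopped_notMem_iff.2 h hy
      simp only [Set.indicator_of_notMem this, stopped_succ_of_mem hy, hA n _ hy, sub_self]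
    · have : y ∈ {y : ℕ → S | ∀ k ≤ n, y k ∉ A} := stopped_notMem_iff.1 hy
      simp only [Set.indicator_of_mem this, stopped_succ_of_notMem hy, stopped_eq_of_notMem hy]

/-- A bounded function that is harmonic off `A` is determined by its values on `A`, provided that
`A` is almost surely visited. -/
lemma eq_integral_firstHit {R : S → S → ℝ} {A : Set S} {g : S → ℝ} {C : ℝ}
    (hg : ∀ s, |g s| ≤ C) (hstep : ∀ s ∉ A, ∫ t, g t ∂(jumpKernel R s) = g s) {s : S}
    (hs : ∀ᵐ y ∂(skeletonLaw R s), firstHit A y ≠ none) :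
    g s = ∫ y, (firstHit A y).elim 0 g ∂(skeletonLaw R s) := by
  have hlim : Tendsto (fun n => ∫ y, g (stopped A y n) ∂(skeletonLaw R s)) atTop
      (𝓝 (∫ y, (firstHit A y).elim 0 g ∂(skeletonLaw R s))) := by
    refine tendsto_integral_of_dominated_convergence (fun _ => C)
      (fun n => (integrable_comp_stopped hg n).aestronglyMeasurable) (integrable_const _)
      (fun n => .of_forall fun y => hg _) ?_
    filter_upwards [hs] with y hy
    rcases exists_first_visit A y with ⟨N, hN, hlt⟩ | hno
    · exact tendsto_stopped hN hlt g
    · exact absurd (firstHit_eq_none hno) hy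
  refine tendsto_nhds_unique (tendsto_const_nhds.congr fun n => ?_) hlim
  exact (integral_stopped_eq (u := fun _ => g) (fun _ => hg) (fun _ _ _ => rfl)
    (fun _ _ => hstep) s).symm

/-- Links the backward recursion to the path integral, so that harmonicity of `hitMean` can be read
off the recursion without a shift of trajectories. -/
lemma tendsto_hitIter (R : S → S → ℝ) (A : Set S) {f : S → ℝ} {C : ℝ} (hf : ∀ s, |f s| ≤ C)
    (s : S) : Tendsto (fun n => hitIter R A f n s) atTop (𝓝 (hitMean R A f s)) := by
  have hind : ∀ s, |A.indicator f s| ≤ C := abs_hitIter_le R A hf 0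
  -- With `f` itself the integrand need not converge on paths that never visit `A`. The indicator
  -- makes it `0` there, matching the default value in `hitMean`.
  have hlim : Tendsto (fun n => ∫ y, A.indicator f (stopped A y n) ∂(skeletonLaw R s)) atTop
      (𝓝 (hitMean R A f s)) := by
    refine tendsto_integral_of_dominated_convergence (fun _ => C)
      (fun n => (integrable_comp_stopped hind n).aestronglyMeasurable) (integrable_const _)
      (fun n => .of_forall fun y => hind _) (.of_forall fun y => ?_)
    rcases exists_first_visit A y with ⟨N, hN, hlt⟩ | hno
    · have := tendsto_stopped hN hlt (A.indicator f)
      simpa [firstHit_eq_some hN hlt, hN] using this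
    · rw [firstHit_eq_none hno]
      refine tendsto_const_nhds.congr fun n => ?_
      have : stopped A y n ∉ A := stopped_notMem_iff.2 fun k _ => hno k
      simp [this]
  refine hlim.congr fun n => ?_
  -- Time is reversed: `n - k` steps remain at the instant `k`. The truncated subtraction is
  -- harmless because harmonicity is needed only for `k < n`.
  have := integral_stopped_eq (R := R) (A := A) (u := fun k => hitIter R A f (n - k)) (n := n)
    (fun k => abs_hitIter_le R A hf _)
    (fun k t ht => by rw [hitIter_of_mem R f _ ht, hitIter_of_mem R f _ ht])
    (fun k hk t ht => by
      rw [← hitIter_succ_of_notMem R f _ ht]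
      congr 1
      omega) s
  simpa [hitIter] using this

lemma hitMean_of_mem (R : S → S → ℝ) {A : Set S} {f : S → ℝ} {C : ℝ} (hf : ∀ s, |f s| ≤ C)
    {s : S} (hs : s ∈ A) : hitMean R A f s = f s :=
  tendsto_nhds_unique (tendsto_hitIter R A hf s)
    (tendsto_const_nhds.congr fun n => (hitIter_of_mem R f n hs).symm)

/-- Pass to the limit in the recursion for `hitIter`, by bounded convergence under the one-step law.
-/
lemma hitMean_harmonic (R : S → S → ℝ) {A : Set S} {f : S → ℝ} {C : ℝ} (hf : ∀ s, |f s| ≤ C)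
    {s : S} (hs : s ∉ A) : ∫ t, hitMean R A f t ∂(jumpKernel R s) = hitMean R A f s := by
  have h₁ : Tendsto (fun n => ∫ t, hitIter R A f n t ∂(jumpKernel R s)) atTop
      (𝓝 (∫ t, hitMean R A f t ∂(jumpKernel R s))) :=
    tendsto_integral_of_dominated_convergence (fun _ => C)
      (fun n => Measurable.of_discrete.aestronglyMeasurable) (integrable_const _)
      (fun n => .of_forall fun t => abs_hitIter_le R A hf n t)
      (.of_forall fun t => tendsto_hitIter R A hf t)
  have h₂ := (tendsto_add_atTop_iff_nat 1).2 (tendsto_hitIter R A hf s)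
  refine tendsto_nhds_unique h₁ (h₂.congr fun n => ?_)
  exact hitIter_succ_of_notMem R f n hs

/-- The mean of a function of the first visited state is the sum of its values, weighted by the
law of this state. -/
lemma hasSum_firstHit {A : Set S} {μ : Measure (ℕ → S)} [IsFiniteMeasure μ] {φ : Option S → ℝ}
    {C : ℝ} (hφ : ∀ z, |φ z| ≤ C) :
    HasSum (fun z => μ.real {y | firstHit A y = z} * φ z) (∫ y, φ (firstHit A y) ∂μ) := by
  let _ : MeasurableSpace (Option S) := ⊤
  have _ : DiscreteMeasurableSpace (Option S) := ⟨fun _ => trivial⟩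
  have hm : Measurable (firstHit A) := fun B _ => measurableSet_firstHit_preimage A B
  have hφm : Measurable φ := Measurable.of_discrete
  have _ := Measure.isFiniteMeasure_map μ (firstHit A)
  have hint : Integrable φ (μ.map (firstHit A)) :=
    Integrable.of_bound hφm.aestronglyMeasurable C (.of_forall hφ)
  rw [← integral_map hm.aemeasurable hφm.aestronglyMeasurable]
  -- On a countable discrete space a measure is the sum of its weighted point masses, so the
  -- integral splits into a series.
  have hsum := hint
  rw [← Measure.sum_smul_dirac (μ.map (firstHit A))] at hsum
  have := hasSum_integral_measure hsum
  rw [Measure.sum_smul_dirac] at this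
  refine this.congr_fun fun z => ?_
  rw [integral_smul_measure, integral_dirac, Measure.map_apply hm trivial]
  rfl

/-- At a state with a conservative row, the mean value property for the jump kernel is the
vanishing of the generator. -/
lemma integral_jumpKernel_eq_iff {R : S → S → ℝ} {s : S} (hneg : R s s < 0)
    (hnn : ∀ t ≠ s, 0 ≤ R s t) (hsum : HasSum (R s) 0) {g : S → ℝ} {C : ℝ}
    (hg : ∀ t, |g t| ≤ C) :
    ∫ t, g t ∂(jumpKernel R s) = g s ↔ HasSum (fun t => R s t * g t) 0 := by
  classical
  -- The normalized row equals `-1` at `s`; adding `1` there leaves exactly the jump probabilities,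
  -- with total mass one since the row sums to zero.
  let q : S → ℝ := fun t => R s t / (-R s s) + if t = s then 1 else 0
  have hq0 : ∀ t, 0 ≤ q t := fun t => by
    by_cases ht : t = s
    · subst ht
      simp only [q, if_true, div_neg, div_self hneg.ne]
      norm_num
    · simpa [q, ht] using div_nonneg (hnn t ht) (neg_nonneg.2 hneg.le)
  have hq : HasSum q 1 := by
    simpa using (hsum.div_const (-R s s)).add (hasSum_ite_eq s (1 : ℝ))
  have hw : ∀ t, jumpWeight R s t = ENNReal.ofReal (q t) := fun t => by
    by_cases ht : t = s
    · subst ht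
      simp [q, jumpWeight, div_neg, div_self hneg.ne]
    · simp [q, jumpWeight, ht]
  have htot : ∑' t, jumpWeight R s t = 1 := by
    simp_rw [hw]
    rw [← ENNReal.ofReal_tsum_of_nonneg hq0 hq.summable, hq.tsum_eq, ENNReal.ofReal_one]
  have hlaw : ∀ t, (jumpLaw R s t).toReal = q t := fun t => by
    have : jumpLaw R s = (⟨jumpWeight R s, htot ▸ ENNReal.summable.hasSum⟩ : PMF S) :=
      dif_pos htot
    rw [this]
    change (jumpWeight R s t).toReal = _
    rw [hw, ENNReal.toReal_ofReal (hq0 t)]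
  have hint : ∫ t, g t ∂(jumpKernel R s) = ∑' t, q t * g t := by
    have hi : Integrable g (jumpLaw R s).toMeasure :=
      Integrable.of_bound (Measurable.of_discrete (f := g)).aestronglyMeasurable C (.of_forall hg)
    change ∫ t, g t ∂(jumpLaw R s).toMeasure = _
    rw [PMF.integral_eq_tsum _ _ hi]
    simp_rw [hlaw, smul_eq_mul]
  have hRg : Summable fun t => R s t * g t := by
    refine Summable.of_norm_bounded (g := fun t => |R s t| * C)
      ((summable_abs_iff.2 hsum.summable).mul_right C) fun t => ?_
    rw [norm_mul]
    exact mul_le_mul_of_nonneg_left (hg t) (abs_nonneg _)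
  have hqg : HasSum (fun t => q t * g t) ((∑' t, R s t * g t) / (-R s s) + g s) := by
    refine ((hRg.hasSum.div_const (-R s s)).add (hasSum_ite_eq s (g s))).congr_fun fun t => ?_
    by_cases ht : t = s
    · subst ht
      simp only [q, if_true]
      ring
    · simp only [q, if_neg ht]
      ring
  rw [hint, hqg.tsum_eq, hRg.hasSum_iff]
  simp [hneg.ne]

end Martingale

/-! ### The minimal tree: local finiteness and conservativity of the extended generator. -/

section Tree

variable {I : Type*} {U : I → I → ℝ}

lemma IsUltrametric.le_diag (hU : IsUltrametric U) (i j : I) : U i j ≤ U i i := by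
  have := hU.ultra i i j
  rwa [hU.symm j i, min_self] at this

lemma IsUltrametric.le_trans (hU : IsUltrametric U) {w : ℝ} {i j k : I} (hij : w ≤ U i j)
    (hjk : w ≤ U j k) : w ≤ U i k :=
  (le_min hij hjk).trans (hU.ultra i k j)

lemma classOf_eq (hU : IsUltrametric U) {w : ℝ} {i j : I} (hij : w ≤ U i j) :
    classOf U w j = classOf U w i := by
  ext k
  exact ⟨fun h => ⟨h.1, hU.le_trans hij h.2⟩,
    fun h => ⟨h.1, hU.le_trans (hU.symm i j ▸ hij) h.2⟩⟩

lemma eq_classOf_of_mem (hU : IsUltrametric U) {E : Set I} {w : ℝ} {i : I}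
    (hE : E ∈ classes U w) (hi : i ∈ E) : w ≤ U i i ∧ E = classOf U w i := by
  obtain ⟨j, -, rfl⟩ := hE
  exact ⟨hi.1, (classOf_eq hU hi.2).symm⟩

lemma exists_mem_cls (a : MinTree U) : ∃ i, i ∈ a.cls := by
  obtain ⟨i, hi, h⟩ := a.cls_mem
  exact ⟨i, by rw [h]; exact ⟨hi, hi⟩⟩

/-- Equal images force `U i i = U j j ≤ U i j`. Every `U i k` is at most `U i i`, hence at most `U i
j`, and the ultrametric inequality gives `U i k ≤ U j k`; by symmetry the two rows coincide, and
(H1) applies. -/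
lemma emb_injective (hU : IsUltrametric U) (h1 : H1 U) : Function.Injective (emb U) := by
  intro i j hij
  have hval : U i i = U j j := congrArg MinTree.val hij
  have hcls : classOf U (U i i) i = classOf U (U j j) j := congrArg MinTree.cls hij
  have hj : U i i ≤ U i j := by
    have : j ∈ classOf U (U i i) i := hcls ▸ ⟨le_rfl, le_rfl⟩
    exact this.2
  refine (h1 i j).1 fun k => le_antisymm ?_ ?_
  · exact hU.le_trans (hU.symm i j ▸ (hU.le_diag i k).trans hj) le_rfl
  · exact hU.le_trans ((hU.le_diag j k).trans (hval ▸ hj)) le_rfl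

instance [Countable I] : Countable (MinTree U) := by
  have hc : (Set.range fun p : I × I × I =>
      (classOf U (U p.2.1 p.2.2) p.1, U p.2.1 p.2.2)).Countable := Set.countable_range _
  have := hc.to_subtype
  refine Function.Injective.countable (f := fun a : MinTree U =>
    (⟨(a.cls, a.val), ?_⟩ : Set.range fun p : I × I × I =>
      (classOf U (U p.2.1 p.2.2) p.1, U p.2.1 p.2.2))) fun a b hab => ?_
  · obtain ⟨i, -, hi⟩ := a.cls_mem
    obtain ⟨j, k, hjk⟩ := a.val_mem
    exact ⟨(i, j, k), by simp [hi, hjk]⟩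
  · have := congrArg Subtype.val hab
    exact MinTree.ext (congrArg Prod.fst this) (congrArg Prod.snd this)

instance {V : Type*} [Countable V] : Countable (WithCemetery V) :=
  Function.Surjective.countable
    (f := fun o : Option V => o.elim WithCemetery.cemetery WithCemetery.site) fun s => by
      cases s with
      | site v => exact ⟨some v, rfl⟩
      | cemetery => exact ⟨none, rfl⟩

/-- By (H2) and compactness only finitely many values lie in `[0, w]`, so the supremum is attained.
The inserted `0` plays the role of `w_{-1}` and makes the set nonempty. -/
lemma prevValue_spec (h2 : H2 U) {w : ℝ} (hw : w ∈ values U) :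
    prevValue U w ∈ insert 0 (values U) ∧ prevValue U w < w ∧
      ∀ v ∈ insert 0 (values U), v < w → v ≤ prevValue U w := by
  have hfin : (values U ∩ Set.Icc 0 w).Finite := by
    by_contra hinf
    obtain ⟨x, -, hx⟩ := Set.Infinite.exists_accPt_of_subset_isCompact hinf isCompact_Icc
      Set.inter_subset_right
    exact h2.2 x (hx.mono (Filter.principal_mono.2 Set.inter_subset_left))
  have hfin' : {v | v ∈ insert 0 (values U) ∧ v < w}.Finite := by
    refine (hfin.insert 0).subset ?_
    rintro v ⟨rfl | hv, hvw⟩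
    · exact Set.mem_insert _ _
    · exact Set.mem_insert_of_mem _ ⟨hv, (h2.1 v hv).le, hvw.le⟩
  have hne : {v | v ∈ insert 0 (values U) ∧ v < w}.Nonempty :=
    ⟨0, Set.mem_insert _ _, h2.1 w hw⟩
  have hmem := hne.csSup_mem hfin'
  exact ⟨hmem.1, hmem.2, fun v hv hvw => le_csSup hfin'.bddAbove ⟨hv, hvw⟩⟩

/-- The neighbors of a site that are closer to the root. -/
def predecessors (U : I → I → ℝ) (a : MinTree U) : Set (MinTree U) :=
  {b | Adj U a b ∧ b.val < a.val}

lemma predecessors_of_root (h2 : H2 U) {a : MinTree U} (ha : ∀ w ∈ values U, a.val ≤ w) :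
    predecessors U a = ∅ ∧ prevValue U a.val = 0 := by
  constructor
  · exact Set.eq_empty_of_forall_notMem fun b hb => absurd (ha _ b.val_mem) (not_le.2 hb.2)
  · obtain ⟨h | h, hlt, -⟩ := prevValue_spec h2 a.val_mem
    · exact h
    · exact absurd (ha _ h) (not_le.2 hlt)

/-- Lowering the level merges classes: the class of any point of `a.cls` at the preceding level
contains all of `a.cls`, so it is the only class of that level that meets it. -/
lemma predecessors_of_not_root (hU : IsUltrametric U) (h2 : H2 U) {a : MinTree U}
    (ha : ¬ ∀ w ∈ values U, a.val ≤ w) :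
    ∃ p : MinTree U, predecessors U a = {p} ∧ p.val = prevValue U a.val := by
  push Not at ha
  obtain ⟨v, hv, hva⟩ := ha
  obtain ⟨hmem, hlt, hmax⟩ := prevValue_spec h2 a.val_mem
  have hpos : 0 < prevValue U a.val :=
    (h2.1 v hv).trans_le (hmax v (Set.mem_insert_of_mem _ hv) hva)
  have hprev : prevValue U a.val ∈ values U := hmem.resolve_left hpos.ne'
  obtain ⟨i, hi⟩ := exists_mem_cls a
  obtain ⟨hia, hcls⟩ := eq_classOf_of_mem hU a.cls_mem hi
  let p : MinTree U :=
    { cls := classOf U (prevValue U a.val) i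
      val := prevValue U a.val
      val_mem := hprev
      cls_mem := ⟨i, hlt.le.trans hia, rfl⟩ }
  refine ⟨p, Set.eq_singleton_iff_unique_mem.2 ⟨⟨⟨Or.inr ⟨hprev, a.val_mem, hlt, ?_⟩, i, hi,
    hlt.le.trans hia, hlt.le.trans hia⟩, hlt⟩, ?_⟩, rfl⟩
  · rintro z hz ⟨hz₁, hz₂⟩
    exact absurd (hmax z (Set.mem_insert_of_mem _ hz) hz₂) (not_le.2 hz₁)
  · rintro b ⟨⟨hc | hc, j, hja, hjb⟩, hba⟩
    · exact absurd hc.2.2.1 (not_lt.2 hba.le)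
    · have hval : b.val = prevValue U a.val := by
        refine le_antisymm (hmax _ (Set.mem_insert_of_mem _ b.val_mem) hba) ?_
        by_contra h
        exact hc.2.2.2 _ hprev ⟨not_le.1 h, hlt⟩
      obtain ⟨-, hb⟩ := eq_classOf_of_mem hU b.cls_mem hjb
      have hij : a.val ≤ U i j := by rw [hcls] at hja; exact hja.2
      refine MinTree.ext ?_ hval
      rw [hb, hval]
      exact classOf_eq hU (hlt.le.trans hij)

lemma val_of_mem_successors {a b : MinTree U} (hb : b ∈ successors U a) :
    b.val = nextValue U a.val := by
  obtain ⟨⟨hc | hc, -⟩, hab⟩ := hb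
  · have : IsLeast {v | v ∈ values U ∧ a.val < v} b.val := by
      refine ⟨⟨b.val_mem, hab⟩, fun v hv => ?_⟩
      by_contra h
      exact hc.2.2.2 v hv.1 ⟨hv.2, not_le.1 h⟩
    exact this.csInf_eq.symm
  · exact absurd hc.2.2.1 (not_lt.2 hab.le)

/-- All successors have the same value, so they are told apart by their classes, of which (H3)
allows finitely many. -/
lemma finite_successors (h3 : H3 U) (a : MinTree U) : (successors U a).Finite := by
  rcases (successors U a).eq_empty_or_nonempty with h | ⟨b₀, hb₀⟩
  · rw [h]; exact Set.finite_empty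
  · refine Set.Finite.of_injOn (f := MinTree.cls) (t := classes U b₀.val) (fun b hb => ?_)
      (fun b hb c hc hbc => ?_) (h3 _ b₀.val_mem)
    · rw [val_of_mem_successors hb₀, ← val_of_mem_successors hb]
      exact b.cls_mem
    · exact MinTree.ext hbc (by rw [val_of_mem_successors hb, val_of_mem_successors hc])

lemma finite_predecessors (hU : IsUltrametric U) (h2 : H2 U) (a : MinTree U) :
    (predecessors U a).Finite := by
  by_cases ha : ∀ w ∈ values U, a.val ≤ w
  · rw [(predecessors_of_root h2 ha).1]; exact Set.finite_empty
  · obtain ⟨p, hp, -⟩ := predecessors_of_not_root hU h2 ha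
    rw [hp]; exact Set.finite_singleton p

lemma val_of_mem_predecessors (hU : IsUltrametric U) (h2 : H2 U) {a b : MinTree U}
    (hb : b ∈ predecessors U a) : b.val = prevValue U a.val := by
  by_cases ha : ∀ w ∈ values U, a.val ≤ w
  · rw [(predecessors_of_root h2 ha).1] at hb; exact absurd hb (Set.notMem_empty b)
  · obtain ⟨p, hp, hval⟩ := predecessors_of_not_root hU h2 ha
    rw [hp] at hb
    rw [Set.mem_singleton_iff.1 hb, hval]

-- On each side of `a` all neighbors share one value, hence one rate. Row sums then reduce to
-- counting successors and predecessors.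
open Classical in
lemma treeGen_eq (hU : IsUltrametric U) (h2 : H2 U) (a b : MinTree U) :
    treeGen U a b =
      (if b = a then -((a.val - prevValue U a.val)⁻¹
        + ((successors U a).ncard : ℝ) * (nextValue U a.val - a.val)⁻¹) else 0)
      + (successors U a).indicator (fun _ => (nextValue U a.val - a.val)⁻¹) b
      + (predecessors U a).indicator (fun _ => (a.val - prevValue U a.val)⁻¹) b := by
  rw [treeGen]
  by_cases hab : a = b
  · subst hab
    have h₁ : a ∉ successors U a := fun h => lt_irrefl _ h.2
    have h₂ : a ∉ predecessors U a := fun h => lt_irrefl _ h.2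
    simp [h₁, h₂]
  · rw [if_neg hab, if_neg (Ne.symm hab), zero_add]
    by_cases hadj : Adj U a b
    · rw [if_pos hadj]
      rcases hadj.1 with hc | hc
      · have h₁ : b ∈ successors U a := ⟨hadj, hc.2.2.1⟩
        have h₂ : b ∉ predecessors U a := fun h => lt_asymm h.2 hc.2.2.1
        rw [Set.indicator_of_mem h₁, Set.indicator_of_notMem h₂, add_zero,
          ← val_of_mem_successors h₁, abs_sub_comm, abs_of_pos (sub_pos.2 hc.2.2.1)]
      · have h₁ : b ∈ predecessors U a := ⟨hadj, hc.2.2.1⟩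
        have h₂ : b ∉ successors U a := fun h => lt_asymm h.2 hc.2.2.1
        rw [Set.indicator_of_mem h₁, Set.indicator_of_notMem h₂, zero_add,
          ← val_of_mem_predecessors hU h2 h₁, abs_of_pos (sub_pos.2 hc.2.2.1)]
    · have h₁ : b ∉ successors U a := fun h => hadj h.1
      have h₂ : b ∉ predecessors U a := fun h => hadj h.1
      simp [hadj, h₁, h₂]

lemma hasSum_indicator_const {V : Type*} {s : Set V} (hs : s.Finite) (c : ℝ) :
    HasSum (s.indicator fun _ => c) (s.ncard * c) := by
  lift s to Finset V using hs
  have : HasSum ((s : Set V).indicator fun _ => c)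
      (∑ b ∈ s, (s : Set V).indicator (fun _ => c) b) :=
    hasSum_sum_of_ne_finset_zero fun b hb => Set.indicator_of_notMem (by simpa using hb) _
  rwa [Finset.sum_congr rfl fun b hb => Set.indicator_of_mem (Finset.mem_coe.2 hb) _,
    Finset.sum_const, nsmul_eq_mul, ← Set.ncard_coe_finset] at this

-- The successors cancel their part of the diagonal, and the single predecessor cancels the rest.
-- The root has no predecessor and preceding value `0`, so `-w_0⁻¹` is left over, to be balanced by
-- the rate towards `∂_r`.
open Classical in
lemma hasSum_treeGen (hU : IsUltrametric U) (h2 : H2 U) (h3 : H3 U) (a : MinTree U) :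
    HasSum (treeGen U a) (-(if ∀ w ∈ values U, a.val ≤ w then a.val⁻¹ else 0)) := by
  have h := ((hasSum_ite_eq a (-((a.val - prevValue U a.val)⁻¹
        + ((successors U a).ncard : ℝ) * (nextValue U a.val - a.val)⁻¹))).add
      (hasSum_indicator_const (finite_successors h3 a) (nextValue U a.val - a.val)⁻¹)).add
      (hasSum_indicator_const (finite_predecessors hU h2 a) (a.val - prevValue U a.val)⁻¹)
  rw [funext (treeGen_eq hU h2 a)]
  convert h using 1
  by_cases ha : ∀ w ∈ values U, a.val ≤ w
  · rw [if_pos ha, (predecessors_of_root h2 ha).1, (predecessors_of_root h2 ha).2]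
    simp
  · obtain ⟨p, hp, -⟩ := predecessors_of_not_root hU h2 ha
    rw [if_neg ha, hp]
    simp

lemma finite_support_treeGen (hU : IsUltrametric U) (h2 : H2 U) (h3 : H3 U) (a : MinTree U) :
    (Function.support (treeGen U a)).Finite := by
  refine (((finite_successors h3 a).union (finite_predecessors hU h2 a)).insert a).subset ?_
  intro b hb
  by_contra hnot
  simp only [Set.mem_insert_iff, Set.mem_union, not_or] at hnot
  exact hb (by simp [treeGen_eq hU h2, hnot])

lemma treeGen_self_neg (h2 : H2 U) (a : MinTree U) : treeGen U a a < 0 := by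
  have h₁ : 0 < (a.val - prevValue U a.val)⁻¹ :=
    inv_pos.2 (sub_pos.2 (prevValue_spec h2 a.val_mem).2.1)
  have h₂ : 0 ≤ ((successors U a).ncard : ℝ) * (nextValue U a.val - a.val)⁻¹ := by
    rcases (successors U a).eq_empty_or_nonempty with h | ⟨b, hb⟩
    · simp [h]
    · refine mul_nonneg (Nat.cast_nonneg _) (inv_nonneg.2 (sub_nonneg.2 ?_))
      rw [← val_of_mem_successors hb]
      exact hb.2.le
  rw [treeGen, if_pos rfl]
  linarith

lemma treeGen_nonneg {a b : MinTree U} (hab : a ≠ b) : 0 ≤ treeGen U a b := by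
  rw [treeGen, if_neg hab]
  split_ifs
  · positivity
  · exact le_rfl

lemma site_injective {V : Type*} : Function.Injective (WithCemetery.site : V → WithCemetery V) :=
  fun _ _ h => WithCemetery.site.inj h

/-- A series over `V ∪ {∂_r}` whose term at `∂_r` vanishes is a series over `V`. -/
lemma hasSum_site_iff {V : Type*} {f : WithCemetery V → ℝ} (hf : f .cemetery = 0) {x : ℝ} :
    HasSum f x ↔ HasSum (fun v => f (.site v)) x := by
  refine (site_injective.hasSum_iff fun s hs => ?_).symm
  cases s with
  | site v => exact absurd ⟨v, rfl⟩ hs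
  | cemetery => exact hf

lemma hasSum_extGen (hU : IsUltrametric U) (h2 : H2 U) (h3 : H3 U) (a : MinTree U) :
    HasSum (extGen U (.site a)) 0 := by
  classical
  let r : ℝ := extGen U (.site a) .cemetery
  -- The entry at `∂_r` is removed, so that the series reduces to the row of the tree, and added
  -- back afterwards.
  let f : WithCemetery (MinTree U) → ℝ := fun s =>
    extGen U (.site a) s - if s = .cemetery then r else 0
  have hf : HasSum f (-r) := by
    rw [hasSum_site_iff (by simp [f, r])]
    refine (hasSum_treeGen hU h2 h3 a).congr_fun fun b => ?_
    simp [f, extGen]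
  have := hf.add (hasSum_ite_eq (WithCemetery.cemetery : WithCemetery (MinTree U)) r)
  rw [neg_add_cancel] at this
  exact this.congr_fun fun s => by simp [f]

lemma notMem_target {s : WithCemetery (MinTree U)} (hs : s ∉ target U) :
    ∃ a, s = .site a ∧ a ∉ Set.range (emb U) := by
  cases s with
  | cemetery => exact absurd (Or.inl rfl) hs
  | site a =>
    refine ⟨a, rfl, ?_⟩
    rintro ⟨i, rfl⟩
    exact hs (Or.inr ⟨i, rfl⟩)

lemma extGen_self_neg (h2 : H2 U) : ∀ s ∉ target U, extGen U s s < 0 := by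
  intro s hs
  obtain ⟨a, rfl, -⟩ := notMem_target hs
  exact treeGen_self_neg h2 a

/-- The mean value property at a site is the vanishing of the generator of the tree. -/
lemma integral_jumpKernel_extGen_iff [Countable I] (hU : IsUltrametric U) (h2 : H2 U)
    (h3 : H3 U) {g : WithCemetery (MinTree U) → ℝ} {C : ℝ} (hg : ∀ s, |g s| ≤ C)
    (hg0 : g .cemetery = 0) (a : MinTree U) :
    ∫ t, g t ∂(jumpKernel (extGen U) (.site a)) = g (.site a) ↔
      HasSum (fun b => treeGen U a b * g (.site b)) 0 := by
  rw [integral_jumpKernel_eq_iff (R := extGen U) (s := .site a) (treeGen_self_neg h2 a) ?_ (hasSum_extGen hU h2 h3 a) hg,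
    hasSum_site_iff (by simp [hg0])]
  · rfl
  · intro t ht
    cases t with
    | site b => exact treeGen_nonneg fun h => ht (h ▸ rfl)
    | cemetery =>
      simp only [extGen]
      split_ifs
      · exact inv_nonneg.2 (h2.1 _ a.val_mem).le
      · exact le_rfl

end Tree

/-! ### The mean of `h` at the exit state, and the passage between `Q` and `Q̃`. -/

section Extension

variable {I : Type*} {U : I → I → ℝ}

/-- The extension of `h` to `Ĩ ∪ {∂_r}` that vanishes outside of `I`. -/
noncomputable def extendZero (U : I → I → ℝ) (h : I → ℝ) : WithCemetery (MinTree U) → ℝ :=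
  Function.extend (fun i => .site (emb U i)) h 0

lemma site_emb_injective (hU : IsUltrametric U) (h1 : H1 U) :
    Function.Injective fun i => (WithCemetery.site (emb U i) : WithCemetery (MinTree U)) :=
  site_injective.comp (emb_injective hU h1)

lemma extendZero_emb (hU : IsUltrametric U) (h1 : H1 U) (h : I → ℝ) (i : I) :
    extendZero U h (.site (emb U i)) = h i :=
  (site_emb_injective hU h1).extend_apply h 0 i

lemma extendZero_of_notMem_range (h : I → ℝ) {s : WithCemetery (MinTree U)}
    (hs : ∀ i, s ≠ .site (emb U i)) : extendZero U h s = 0 :=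
  Function.extend_apply' _ _ _ fun ⟨i, hi⟩ => hs i hi.symm

lemma abs_extendZero_le (hU : IsUltrametric U) (h1 : H1 U) {h : I → ℝ} {C : ℝ}
    (hC : ∀ i, |h i| ≤ C) (s : WithCemetery (MinTree U)) : |extendZero U h s| ≤ |C| := by
  by_cases hs : ∃ i, s = .site (emb U i)
  · obtain ⟨i, rfl⟩ := hs
    rw [extendZero_emb hU h1]
    exact (hC i).trans (le_abs_self C)
  · rw [extendZero_of_notMem_range h (not_exists.1 hs), abs_zero]
    exact abs_nonneg C

lemma exitValue_eq (hU : IsUltrametric U) (h1 : H1 U) (h : I → ℝ)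
    (ω : Path (WithCemetery (MinTree U))) :
    exitValue U h ω = (exitState U ω).elim 0 (extendZero U h) := by
  have hinj : Function.Injective fun i : I => some (WithCemetery.site (emb U i)) :=
    (Option.some_injective _).comp (site_emb_injective hU h1)
  rw [exitValue]
  by_cases hs : ∃ i, some (WithCemetery.site (emb U i)) = exitState U ω
  · obtain ⟨i, hi⟩ := hs
    rw [← hi, hinj.extend_apply]
    exact (extendZero_emb hU h1 h i).symm
  · rw [Function.extend_apply' _ _ _ hs]
    cases hz : exitState U ω with
    | none => rfl
    | some s =>
      exact (extendZero_of_notMem_range h fun i hi => hs ⟨i, by rw [hz, hi]⟩).symm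

lemma exitState_ae_eq (h2 : H2 U) (a : MinTree U) :
    ∀ᵐ ω ∂(treeLaw U a), exitState U ω = firstHit (target U) ω.1 :=
  hitState_ae_eq (extGen_self_neg h2) _

lemma exitValue_ae_eq (hU : IsUltrametric U) (h1 : H1 U) (h2 : H2 U) (h : I → ℝ)
    (a : MinTree U) :
    ∀ᵐ ω ∂(treeLaw U a), exitValue U h ω = (firstHit (target U) ω.1).elim 0 (extendZero U h) := by
  filter_upwards [exitState_ae_eq h2 a] with ω hω
  rw [exitValue_eq hU h1, hω]

variable [Countable I]

lemma integral_exitValue (hU : IsUltrametric U) (h1 : H1 U) (h2 : H2 U) (h : I → ℝ)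
    (a : MinTree U) :
    ∫ ω, exitValue U h ω ∂(treeLaw U a) =
      hitMean (extGen U) (target U) (extendZero U h) (.site a) := by
  have hmp := measurePreserving_fst_chainLaw (extGen U) (.site a)
  rw [integral_congr_ae (exitValue_ae_eq hU h1 h2 h a), hitMean, ← hmp.map_eq,
    integral_map hmp.measurable.aemeasurable
      (measurable_comp_firstHit _ fun z => z.elim 0 (extendZero U h)).aestronglyMeasurable]
  rfl

lemma integrable_exitValue (hU : IsUltrametric U) (h1 : H1 U) (h2 : H2 U) {h : I → ℝ} {C : ℝ}
    (hC : ∀ i, |h i| ≤ C) (a : MinTree U) : Integrable (exitValue U h) (treeLaw U a) := by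
  have _ : IsProbabilityMeasure (treeLaw U a) := by unfold treeLaw; infer_instance
  have hm : Measurable fun ω : Path (WithCemetery (MinTree U)) =>
      (firstHit (target U) ω.1).elim 0 (extendZero U h) :=
    (measurable_comp_firstHit (target U) fun z => z.elim 0 (extendZero U h)).comp measurable_fst
  have hae : exitValue U h =ᵐ[treeLaw U a] fun ω =>
      (firstHit (target U) ω.1).elim 0 (extendZero U h) := exitValue_ae_eq hU h1 h2 h a
  exact (Integrable.of_bound hm.aestronglyMeasurable |C|
    (.of_forall fun ω => abs_elim_le (abs_nonneg C) (abs_extendZero_le hU h1 hC) _)).congr hae.symm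

/-- Only the first-visit event needs to be measurable: the event for `exitState` differs from its
preimage by a null set. -/
lemma treeLaw_exitState (h2 : H2 U) (a : MinTree U) (B : Set (Option (WithCemetery (MinTree U)))) :
    treeLaw U a {ω | exitState U ω ∈ B} =
      skeletonLaw (extGen U) (.site a) {y | firstHit (target U) y ∈ B} := by
  have hmp := measurePreserving_fst_chainLaw (extGen U) (.site a)
  have hB : MeasurableSet {y | firstHit (target U) y ∈ B} :=
    measurableSet_firstHit_preimage (target U) B
  rw [← hmp.measure_preimage hB.nullMeasurableSet]
  refine measure_congr ?_
  filter_upwards [exitState_ae_eq h2 a] with ω hω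
  exact congrArg (· ∈ B) hω

/-- Under (H4) the skeleton started outside of `I` almost surely visits the target. -/
lemma firstHit_ae_ne_none (h2 : H2 U) (h4 : H4 U) {a : MinTree U}
    (ha : a ∉ Set.range (emb U)) :
    ∀ᵐ y ∂(skeletonLaw (extGen U) (.site a)), firstHit (target U) y ≠ none := by
  have h := h4 a ha
  have hB : MeasurableSet
      {y | firstHit (target U) y ∈ {z | ∃ s ∈ target U, z = some s}} :=
    measurableSet_firstHit_preimage (target U) _
  have h' := treeLaw_exitState h2 a {z | ∃ s ∈ target U, z = some s}
  have hone := h'.symm.trans h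
  filter_upwards [(prob_compl_eq_zero_iff hB).2 hone] with y hy hnone
  obtain ⟨s, -, hs⟩ := hy
  rw [hnone] at hs
  exact absurd hs (by simp)

/-- The mean of `h(X_τ)` as a series over `I`. -/
lemma hasSum_exit (hU : IsUltrametric U) (h1 : H1 U) (h2 : H2 U) {h : I → ℝ} {C : ℝ}
    (hC : ∀ i, |h i| ≤ C) (a : MinTree U) :
    HasSum (fun j => (treeLaw U a).real {ω | exitState U ω = some (.site (emb U j))} * h j)
      (hitMean (extGen U) (target U) (extendZero U h) (.site a)) := by
  have hinj : Function.Injective fun i : I => some (WithCemetery.site (emb U i)) :=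
    (Option.some_injective _).comp (site_emb_injective hU h1)
  have hsum := hasSum_firstHit (A := target U) (μ := skeletonLaw (extGen U) (.site a))
    (φ := fun z => z.elim 0 (extendZero U h))
    (abs_elim_le (abs_nonneg C) (abs_extendZero_le hU h1 hC))
  -- Exit states outside of `I`, including `∂_r` and `none`, carry the value `0` and drop out of the
  -- series.
  rw [← hinj.hasSum_iff] at hsum
  · refine hsum.congr_fun fun j => ?_
    have := treeLaw_exitState h2 a {some (.site (emb U j))}
    simp only [Set.mem_singleton_iff] at this
    simp [measureReal_def, this, extendZero_emb hU h1]
  · intro z hz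
    cases z with
    | none => simp
    | some s =>
      have : extendZero U h s = 0 := extendZero_of_notMem_range h fun i hi => hz ⟨i, by rw [hi]⟩
      simp [this]

lemma hitMean_emb (hU : IsUltrametric U) (h1 : H1 U) {h : I → ℝ} {C : ℝ}
    (hC : ∀ i, |h i| ≤ C) (i : I) :
    hitMean (extGen U) (target U) (extendZero U h) (.site (emb U i)) = h i := by
  rw [hitMean_of_mem _ (abs_extendZero_le hU h1 hC) (Or.inr ⟨i, rfl⟩), extendZero_emb hU h1]

lemma hitMean_cemetery (hU : IsUltrametric U) (h1 : H1 U) {h : I → ℝ} {C : ℝ}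
    (hC : ∀ i, |h i| ≤ C) :
    hitMean (extGen U) (target U) (extendZero U h) .cemetery = 0 := by
  rw [hitMean_of_mem _ (abs_extendZero_le hU h1 hC) (Or.inl rfl)]
  exact extendZero_of_notMem_range h fun i hi => by cases hi

/-- At the sites of `I`, harmonicity for `Q̃` of the extension is harmonicity of `h` for `Q`. -/
lemma hasSum_treeGen_hitMean_emb (hU : IsUltrametric U) (h1 : H1 U) (h2 : H2 U) (h3 : H3 U)
    {h : I → ℝ} {C : ℝ} (hC : ∀ i, |h i| ≤ C) {i : I}
    (hharm : HasSum (fun j => gen U i j * h j) 0) :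
    HasSum (fun b => treeGen U (emb U i) b *
      hitMean (extGen U) (target U) (extendZero U h) (.site b)) 0 := by
  let h' : MinTree U → ℝ := fun b => hitMean (extGen U) (target U) (extendZero U h) (.site b)
  let q : MinTree U → ℝ := treeGen U (emb U i)
  let P : MinTree U → I → ℝ := fun k j =>
    (treeLaw U k).real {ω | exitState U ω = some (.site (emb U j))}
  have hfin : (Function.support q).Finite := finite_support_treeGen hU h2 h3 _
  have hinj := emb_injective hU h1
  have hF : Summable fun b => q b * h' b :=
    summable_of_hasFiniteSupport (hfin.subset (Function.support_mul_subset_left _ _))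
  have hrange := (hF.comp_injective hinj).hasSum
  have hfin' : (Function.support fun k : {k // k ∉ Set.range (emb U)} => q k).Finite :=
    hfin.preimage Subtype.val_injective.injOn
  let T : Finset {k // k ∉ Set.range (emb U)} := hfin'.toFinset
  have hT : ∀ k ∉ T, q k = 0 := fun k hk => by simpa [T] using hk
  have hcompl : HasSum (fun k : {k // k ∉ Set.range (emb U)} => q k * h' k)
      (∑ k ∈ T, q k * h' k) :=
    hasSum_sum_of_ne_finset_zero fun k hk => by rw [hT k hk, zero_mul]
  -- The exchange of summations: finitely many neighbors `k` outside of `I`, each with a convergent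
  -- series over `j`.
  have hmix : HasSum (fun j => ∑ k ∈ T, q k * (P k j * h j)) (∑ k ∈ T, q k * h' k) :=
    hasSum_sum fun k _ => (hasSum_exit hU h1 h2 hC (k : MinTree U)).mul_left _
  have hgen : HasSum (fun j => gen U i j * h j) _ := (hrange.add hmix).congr_fun fun j => by
    have : ∑' k : {k // k ∉ Set.range (emb U)}, q k * P k j = ∑ k ∈ T, q k * P k j :=
      tsum_eq_sum fun k hk => by rw [hT k hk, zero_mul]
    have hj : h' (emb U j) = h j := hitMean_emb hU h1 hC j
    change (q (emb U j) + ∑' k : {k // k ∉ Set.range (emb U)}, q k * P k j) * h j =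
      q (emb U j) * h' (emb U j) + _
    rw [this, hj, add_mul, Finset.sum_mul]
    simp only [mul_assoc]
  -- The sum of `Q h` at `i` is both `0` and the sum of `Q̃ h'` split into sites of `I` and the
  -- others.
  rw [hharm.unique hgen]
  exact HasSum.add_compl (s := Set.range (emb U)) (hinj.hasSum_range_iff.2 hrange) hcompl

end Extension

end UltraTree

/-! ### Existence and uniqueness of the bounded harmonic extension. -/

theorem mainTheorem8 {I : Type*} [Countable I] (U : I → I → ℝ)
    (hU : UltraTree.IsUltrametric U)
    (h1 : UltraTree.H1 U) (h2 : UltraTree.H2 U) (h3 : UltraTree.H3 U) (h4 : UltraTree.H4 U)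
    (h : I → ℝ) (hbdd : UltraTree.IsBoundedFun h)
    (hharm : UltraTree.IsHarmonic (UltraTree.gen U) h) :
    ∃ h' : UltraTree.MinTree U → ℝ,
      (∀ i, h' (UltraTree.emb U i) = h i) ∧
      UltraTree.IsBoundedFun h' ∧
      UltraTree.IsHarmonic (UltraTree.treeGen U) h' ∧
      (∀ a, Integrable (UltraTree.exitValue U h) (UltraTree.treeLaw U a) ∧
        h' a = ∫ ω, UltraTree.exitValue U h ω ∂(UltraTree.treeLaw U a)) ∧
      ∀ g : UltraTree.MinTree U → ℝ,
        (∀ i, g (UltraTree.emb U i) = h i) →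
        UltraTree.IsBoundedFun g →
        UltraTree.IsHarmonic (UltraTree.treeGen U) g →
        g = h' := by
  open UltraTree in
  obtain ⟨C, hC⟩ := hbdd
  have hf := abs_extendZero_le hU h1 hC
  refine ⟨fun a => hitMean (extGen U) (target U) (extendZero U h) (.site a),
    hitMean_emb hU h1 hC, ⟨|C|, fun a => abs_hitMean_le _ _ hf _⟩, fun a => ?_,
    fun a => ⟨integrable_exitValue hU h1 h2 hC a, (integral_exitValue hU h1 h2 h a).symm⟩,
    fun g hgI ⟨D, hD⟩ hgharm => funext fun a => ?_⟩
  · by_cases ha : a ∈ Set.range (emb U)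
    · obtain ⟨i, rfl⟩ := ha
      exact hasSum_treeGen_hitMean_emb hU h1 h2 h3 hC (hharm i)
    · refine (integral_jumpKernel_extGen_iff hU h2 h3 (abs_hitMean_le _ _ hf)
        (hitMean_cemetery hU h1 hC) a).1 (hitMean_harmonic _ hf ?_)
      rintro (h0 | ⟨i, hi⟩)
      · cases h0
      · exact ha ⟨i, (site_injective hi).symm⟩
  · by_cases ha : a ∈ Set.range (emb U)
    · obtain ⟨i, rfl⟩ := ha
      exact (hgI i).trans (hitMean_emb hU h1 hC i).symm
    · let g' : WithCemetery (MinTree U) → ℝ := fun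
        | .site b => g b
        | .cemetery => 0
      have hg' : ∀ s, |g' s| ≤ |D| := by
        rintro (b | _)
        · exact (hD b).trans (le_abs_self D)
        · simp [g']
      have hstep : ∀ s ∉ target U, ∫ t, g' t ∂(jumpKernel (extGen U) s) = g' s := by
        intro s hs
        obtain ⟨b, rfl, -⟩ := notMem_target hs
        exact (integral_jumpKernel_extGen_iff hU h2 h3 hg' rfl b).2 (hgharm b)
      refine (eq_integral_firstHit hg' hstep (firstHit_ae_ne_none h2 h4 ha)).trans ?_
      -- The first visited state lies in the target, where `g'` and the zero extension of `h` agree.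
      refine integral_congr_ae (.of_forall fun y => ?_)
      rcases exists_first_visit (target U) y with ⟨N, hN, hlt⟩ | hno
      · simp only [firstHit_eq_some hN hlt, Option.elim_some]
        rcases hN with hN | ⟨i, hN⟩
        · rw [hN, extendZero_of_notMem_range h fun i hi => by cases hi]
        · rw [hN, extendZero_emb hU h1]
          exact hgI i
      · simp only [firstHit_eq_none hno, Option.elim_none]
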